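/- Let $d\ge 1$, let $\Omega\subset\mathbb{R}^d$ be bounded and open (for instance a bounded Lipschitz domain), and let $\nu,T>0$. Then there is a constant $C>0$, depending on no discretization parameter or data (only on $\Omega$, $\nu$ and $T$), such that the following holds. Let $V^h$ be a finite dimensional subspace of $H_0^1(\Omega)$ (for instance a conforming finite element space), $N\ge 2$, $\Delta t=T/(N-1)$, $t_n=(n-1)\Delta t$, and $f^n=f(t_n)\in L^2(\Omega)$. Let $u^1,\dots,u^N\in V^h$ solve the backward Euler scheme for the heat equation, $$\Big(\frac{u^{n+1}-u^n}{\Delta t},v\Big)_{L^2}+\nu(\nabla u^{n+1},\nabla v)_{L^2}=(f^{n+1},v)_{L^2}\qquad\forall v\in V^h,\quad 1\le n\le N-1 .$$ Put $\partial u^n=(u^{n+1}-u^n)/\Delta t$, let $S=\mathbb{R}^N$ carry the inner product $(g,h)_S=g^1h^1+\sum_{j=2}^{N}\Delta t\,g^jh^j$, and let $K_1:S\to L^2(\Omega)$, $$K_1 g=g^1u^1+\sum_{j=1}^{N-1}\Delta t\,g^{j+1}\,\partial u^j ,$$ be the POD operator of the new difference quotient approach. Let $$K_1g=\sum_{i=1}^m(\lambda_i^{DQ1})^{1/2}(g,f_i)_S\,\varphi_i$$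 be a singular value decomposition of $K_1$, with $\lambda_1^{DQ1}\ge\dots\ge\lambda_m^{DQ1}\ge 0$, the $f_i$ orthonormal in $S$, and the POD modes $\varphi_i\in V^h$ orthonormal in $L^2(\Omega)$; let $s$ be the number of positive $\lambda_i^{DQ1}$. For $r\ge 0$ let $V_r^h$ be the span of the modes $\varphi_i$ with $i\le r$, and let $R_r$ be the Ritz projection onto $V_r^h$, that is, $R_rw\in V_r^h$ and $(\nabla(w-R_rw),\nabla v_r)_{L^2}=0$ for all $v_r\in V_r^h$. Let $u_r^1,\dots,u_r^N\in V_r^h$ solve the BE-POD-ROM $$\Big(\frac{u_r^{n+1}-u_r^n}{\Delta t},v_r\Big)_{L^2}+\nu(\nabla u_r^{n+1},\nabla v_r)_{L^2}=(f^{n+1},v_r)_{L^2}\qquad\forall v_r\in V_r^h,\quad 1\le n\le N-1,$$ with an arbitrary initial value $u_r^1\in V_r^h$ (for instance the $L^2$ projection $\sum_{i\le r}(u^1,\varphi_i)_{L^2}\varphi_i$). Put $e^k=u^k-u_r^k$ and $\phi_r^1=u_r^1-R_ru^1$. Then $$\max_{1\le k\le N}\|e^k\|_{L^2}^2\le C\Big(\sum_{i=r+1}^{s}\lambda_i^{DQ1}\,\|\varphi_i-R_r\varphi_i\|_{L^2}^2+\|\phi_r^1\|_{L^2}^2\Big).$$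 -/

import Mathlib

open MeasureTheory Filter Topology
open scoped ContDiff InnerProductSpace

noncomputable section

namespace PodHeat

/-- A bounded open subset of `ℝ^d`, the spatial domain. -/
structure BoundedDomain (d : ℕ) where
  carrier : Set (EuclideanSpace ℝ (Fin d))
  isOpen : IsOpen carrier
  isBounded : Bornology.IsBounded carrier

variable {d : ℕ}

/-- The real space `L²(Ω)`. -/
abbrev L2 (Ω : BoundedDomain d) : Type :=
  Lp ℝ 2 (volume.restrict Ω.carrier)

/-- The space `L²(Ω; ℝ^d)` of square integrable vector fields. -/
abbrev L2Vec (Ω : BoundedDomain d) : Type :=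
  Lp (EuclideanSpace ℝ (Fin d)) 2 (volume.restrict Ω.carrier)

/-- Test functions: smooth functions with compact support contained in `Ω`. -/
def IsTestFunction (Ω : BoundedDomain d) (ψ : EuclideanSpace ℝ (Fin d) → ℝ) : Prop :=
  ContDiff ℝ ∞ ψ ∧ HasCompactSupport ψ ∧ tsupport ψ ⊆ Ω.carrier

/-- The pairs `(ψ, ∇ψ)` with `ψ` a test function, as a subspace of `L²(Ω) × L²(Ω; ℝ^d)`. -/
def testPairs (Ω : BoundedDomain d) : Submodule ℝ (L2 Ω × L2Vec Ω) where
  carrier := {p | ∃ ψ, IsTestFunction Ω ψ ∧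
    p.1 =ᵐ[volume.restrict Ω.carrier] ψ ∧ p.2 =ᵐ[volume.restrict Ω.carrier] gradient ψ}
  zero_mem' := by
    refine ⟨0, ⟨contDiff_const, HasCompactSupport.zero, by simp [tsupport]⟩,
      Lp.coeFn_zero _ _ _, ?_⟩
    have h : gradient (0 : EuclideanSpace ℝ (Fin d) → ℝ) = 0 := by
      funext x
      exact gradient_fun_const x 0
    rw [h]
    exact Lp.coeFn_zero _ _ _
  add_mem' := by
    rintro p q ⟨ψ, ⟨hψ, hψc, hψs⟩, h1, h2⟩ ⟨χ, ⟨hχ, hχc, hχs⟩, h3, h4⟩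
    refine ⟨ψ + χ, ⟨hψ.add hχ, hψc.add hχc,
      (tsupport_add ψ χ).trans (Set.union_subset hψs hχs)⟩, ?_, ?_⟩
    · exact (Lp.coeFn_add _ _).trans (h1.add h3)
    · have h : gradient (ψ + χ) = gradient ψ + gradient χ := by
        funext x
        simp only [gradient, Pi.add_apply]
        rw [fderiv_add (hψ.differentiable (by simp)).differentiableAt
          (hχ.differentiable (by simp)).differentiableAt, map_add]
      rw [h]
      exact (Lp.coeFn_add _ _).trans (h2.add h4)
  smul_mem' := by
    rintro c p ⟨ψ, ⟨hψ, hψc, hψs⟩, h1, h2⟩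
    refine ⟨c • ψ, ⟨hψ.const_smul c, hψc.smul_left (f := fun _ => c),
      (closure_mono (Function.support_const_smul_subset c ψ)).trans hψs⟩, ?_, ?_⟩
    · exact (Lp.coeFn_smul _ _).trans (h1.const_smul c)
    · have h : gradient (c • ψ) = c • gradient ψ := by
        funext x
        simp only [gradient, Pi.smul_apply]
        rw [fderiv_const_smul (hψ.differentiable (by simp)).differentiableAt]
        simp
      rw [h]
      exact (Lp.coeFn_smul _ _).trans (h2.const_smul c)

/-- The Sobolev space `H¹₀(Ω)`, the closure of the test functions in the norm of `H¹(Ω)`. An element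
is represented by the pair `(u, ∇u)`, the limit in `L²(Ω) × L²(Ω; ℝ^d)` of pairs `(ψ_n, ∇ψ_n)` with
test functions `ψ_n`; the second component is the weak gradient of the first one. -/
abbrev H10 (Ω : BoundedDomain d) : Type :=
  (testPairs Ω).topologicalClosure

/-- The function in `L²(Ω)` that underlies an element of `H¹₀(Ω)`. -/
def toL2 (Ω : BoundedDomain d) : H10 Ω →ₗ[ℝ] L2 Ω :=
  LinearMap.fst ℝ (L2 Ω) (L2Vec Ω) ∘ₗ (testPairs Ω).topologicalClosure.subtype

/-- The gradient of an element of `H¹₀(Ω)`. -/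
def grad (Ω : BoundedDomain d) : H10 Ω →ₗ[ℝ] L2Vec Ω :=
  LinearMap.snd ℝ (L2 Ω) (L2Vec Ω) ∘ₗ (testPairs Ω).topologicalClosure.subtype

/-- The second component of an element of `H¹₀(Ω)` is the weak gradient of the first one: the
integration by parts formula holds against all test functions. -/
theorem grad_isWeakGradient (Ω : BoundedDomain d) (v : H10 Ω)
    {χ : EuclideanSpace ℝ (Fin d) → ℝ} (hχ : IsTestFunction Ω χ) (e : EuclideanSpace ℝ (Fin d)) :
    ∫ x in Ω.carrier, χ x * ⟪e, grad Ω v x⟫_ℝ =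
      -∫ x in Ω.carrier, fderiv ℝ χ x e * toL2 Ω v x := by
  obtain ⟨hχ1, hχc, hχs⟩ := hχ
  have hd : Continuous fun x => fderiv ℝ χ x e :=
    (hχ1.continuous_fderiv (by simp)).clm_apply continuous_const
  have hdc : HasCompactSupport fun x => fderiv ℝ χ x e := hχc.fderiv_apply (𝕜 := ℝ) e
  have hm1 : MemLp (fun x => fderiv ℝ χ x e) 2 (volume.restrict Ω.carrier) :=
    hd.memLp_of_hasCompactSupport hdc
  have hm2 : MemLp (fun x => χ x • e) 2 (volume.restrict Ω.carrier) :=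
    (hχ1.continuous.smul continuous_const).memLp_of_hasCompactSupport hχc.smul_right
  have e1 : ∀ p : L2 Ω × L2Vec Ω,
      ⟪hm2.toLp _, p.2⟫_ℝ = ∫ x in Ω.carrier, χ x * ⟪e, p.2 x⟫_ℝ := by
    intro p
    rw [L2.inner_def]
    refine integral_congr_ae ?_
    filter_upwards [hm2.coeFn_toLp] with x hx
    rw [hx, real_inner_smul_left]
  have e2 : ∀ p : L2 Ω × L2Vec Ω,
      ⟪hm1.toLp _, p.1⟫_ℝ = ∫ x in Ω.carrier, fderiv ℝ χ x e * p.1 x := by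
    intro p
    rw [L2.inner_def]
    refine integral_congr_ae ?_
    filter_upwards [hm1.coeFn_toLp] with x hx
    rw [hx]
    exact mul_comm _ _
  have hclosed : IsClosed {p : L2 Ω × L2Vec Ω |
      ⟪hm2.toLp _, p.2⟫_ℝ = -⟪hm1.toLp _, p.1⟫_ℝ} :=
    isClosed_eq (by fun_prop) (by fun_prop)
  have htest : ∀ p ∈ testPairs Ω, ⟪hm2.toLp _, p.2⟫_ℝ = -⟪hm1.toLp _, p.1⟫_ℝ := by
    rintro ⟨u, g⟩ ⟨ψ, ⟨hψ, hc, hs⟩, h1, h2⟩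
    rw [e1, e2]
    simp only at h1 h2 ⊢
    have hψd : Differentiable ℝ ψ := hψ.differentiable (by simp)
    have hχd : Differentiable ℝ χ := hχ1.differentiable (by simp)
    have hψe : Continuous fun x => fderiv ℝ ψ x e :=
      (hψ.continuous_fderiv (by simp)).clm_apply continuous_const
    have hsupp : ∀ x, x ∉ Ω.carrier → χ x = 0 := fun x hx =>
      image_eq_zero_of_notMem_tsupport fun h => hx (hχs h)
    have hsupp' : ∀ x, x ∉ Ω.carrier → ψ x = 0 := fun x hx =>
      image_eq_zero_of_notMem_tsupport fun h => hx (hs h)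
    have i1 : ∫ x in Ω.carrier, χ x * ⟪e, g x⟫_ℝ = ∫ x, χ x * fderiv ℝ ψ x e := by
      rw [← setIntegral_eq_integral_of_forall_compl_eq_zero (s := Ω.carrier)
        (f := fun x => χ x * fderiv ℝ ψ x e) (fun x hx => by simp [hsupp x hx])]
      refine integral_congr_ae ?_
      filter_upwards [h2] with x hx
      rw [hx, real_inner_comm, inner_gradient_left]
    have i2 : ∫ x in Ω.carrier, fderiv ℝ χ x e * u x = ∫ x, fderiv ℝ χ x e * ψ x := by
      rw [← setIntegral_eq_integral_of_forall_compl_eq_zero (s := Ω.carrier)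
        (f := fun x => fderiv ℝ χ x e * ψ x) (fun x hx => by simp [hsupp' x hx])]
      refine integral_congr_ae ?_
      filter_upwards [h1] with x hx
      rw [hx]
    have hint : ∀ h : EuclideanSpace ℝ (Fin d) → ℝ, Continuous h → HasCompactSupport h →
        Integrable h volume := fun h h1 h2 => h1.integrable_of_hasCompactSupport h2
    rw [i1, i2]
    exact integral_mul_fderiv_eq_neg_fderiv_mul_of_integrable
      (hint _ (hd.mul hψ.continuous) hdc.mul_right)
      (hint _ (hχ1.continuous.mul hψe) hχc.mul_right)
      (hint _ (hχ1.continuous.mul hψ.continuous) hχc.mul_right)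
      (fun x _ => hχd x) (fun x _ => hψd x)
  have h : ⟪hm2.toLp _, v.1.2⟫_ℝ = -⟪hm1.toLp _, v.1.1⟫_ℝ := closure_minimal htest hclosed v.2
  rw [e1, e2] at h
  exact h

/-- An element of `H¹₀(Ω)` is determined by the function in `L²(Ω)` that underlies it. -/
theorem toL2_injective (Ω : BoundedDomain d) : Function.Injective (toL2 Ω) := by
  rw [injective_iff_map_eq_zero]
  intro v hv
  have hg : ∀ e : EuclideanSpace ℝ (Fin d),
      ∀ᵐ x ∂volume.restrict Ω.carrier, ⟪e, grad Ω v x⟫_ℝ = 0 := by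
    intro e
    rw [ae_restrict_iff' Ω.isOpen.measurableSet]
    refine Ω.isOpen.ae_eq_zero_of_integral_contDiff_smul_eq_zero ?_ ?_
    · have : MemLp (fun x => ⟪e, grad Ω v x⟫_ℝ) 2 (volume.restrict Ω.carrier) :=
        (Lp.memLp (grad Ω v)).const_inner e
      have hfin : IsFiniteMeasure (volume.restrict Ω.carrier) :=
        ⟨by simpa using Ω.isBounded.measure_lt_top⟩
      have h1 : IntegrableOn (fun x => ⟪e, grad Ω v x⟫_ℝ) Ω.carrier volume :=
        this.integrable (by norm_num)
      exact h1.locallyIntegrableOn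
    · intro χ h1 h2 h3
      have h := grad_isWeakGradient Ω v ⟨h1, h2, h3⟩ e
      have hz : ∫ x in Ω.carrier, fderiv ℝ χ x e * toL2 Ω v x = 0 := by
        rw [hv]
        refine integral_eq_zero_of_ae ?_
        filter_upwards [Lp.coeFn_zero ℝ 2 (volume.restrict Ω.carrier)] with x hx
        rw [hx]
        simp
      rw [hz, neg_zero] at h
      rw [← h]
      symm
      refine setIntegral_eq_integral_of_forall_compl_eq_zero fun x hx => ?_
      have : χ x = 0 := image_eq_zero_of_notMem_tsupport fun h => hx (h3 h)
      simp [this]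
  have hg0 : grad Ω v = 0 := by
    refine Lp.ext ?_
    have hall : ∀ᵐ x ∂volume.restrict Ω.carrier, ∀ i : Fin d,
        ⟪EuclideanSpace.single i (1 : ℝ), grad Ω v x⟫_ℝ = 0 :=
      ae_all_iff.mpr fun i => hg _
    filter_upwards [hall, Lp.coeFn_zero (EuclideanSpace ℝ (Fin d)) 2
      (volume.restrict Ω.carrier)] with x hx h0
    rw [h0]
    ext i
    simpa [EuclideanSpace.inner_single_left] using hx i
  exact Subtype.ext (Prod.ext hv hg0)

/-- The Poincaré inequality for smooth functions with compact support. -/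
theorem poincare_smooth {E : Type*} [NormedAddCommGroup E] [InnerProductSpace ℝ E]
    [FiniteDimensional ℝ E] [MeasurableSpace E] [BorelSpace E] (μ : Measure E)
    [μ.IsAddHaarMeasure] (e : E) (hne : ‖e‖ = 1) {ψ : E → ℝ} {R : ℝ}
    (hψ : ContDiff ℝ ∞ ψ) (hc : HasCompactSupport ψ)
    (hs : ∀ x, ψ x ≠ 0 → ‖x‖ ≤ R) :
    ∫ x, ψ x ^ 2 ∂μ ≤ 4 * R ^ 2 * ∫ x, ‖gradient ψ x‖ ^ 2 ∂μ := by
  have hd1 : Differentiable ℝ ψ := hψ.differentiable (by simp)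
  have hcf : Continuous (fderiv ℝ ψ) := hψ.continuous_fderiv (by simp)
  have hcg : Continuous (gradient ψ) :=
    (InnerProductSpace.toDual ℝ E).symm.continuous.comp hcf
  have hgc : HasCompactSupport (gradient ψ) := by
    have := hc.fderiv (𝕜 := ℝ)
    exact this.comp_left (g := (InnerProductSpace.toDual ℝ E).symm)
      (map_zero _)
  obtain ⟨l, hle, hnl⟩ : ∃ l : E →L[ℝ] ℝ, l e = 1 ∧ ∀ x, |l x| ≤ ‖x‖ := by
    refine ⟨innerSL ℝ e, by simp [hne], fun x => ?_⟩
    have := abs_real_inner_le_norm e x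
    rw [hne, one_mul] at this
    simpa using this
  have hdsq : ∀ x, fderiv ℝ (fun y => ψ y ^ 2) x e = 2 * ψ x * fderiv ℝ ψ x e := by
    intro x
    have := ((hd1 x).hasFDerivAt.pow 2).fderiv
    rw [this]
    simp
  have hsqc : HasCompactSupport fun x => ψ x ^ 2 := hc.comp_left (g := fun t : ℝ => t ^ 2) (by simp)
  have hpc : HasCompactSupport fun x => 2 * ψ x * fderiv ℝ ψ x e := by
    have : HasCompactSupport fun x => ψ x * (2 * fderiv ℝ ψ x e) := hc.mul_right
    convert this using 2
    ring
  have hdc : Continuous fun x => fderiv ℝ ψ x e := hcf.clm_apply continuous_const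
  have hint : ∀ h : E → ℝ, Continuous h → HasCompactSupport h →
      Integrable h μ := fun h h1 h2 => h1.integrable_of_hasCompactSupport h2
  have hsq : Continuous fun x => ψ x ^ 2 := hψ.continuous.pow 2
  have hprod : Continuous fun x => 2 * ψ x * fderiv ℝ ψ x e :=
    (continuous_const.mul hψ.continuous).mul hdc
  have a1 : Integrable (fun x => 2 * ψ x * fderiv ℝ ψ x e * l x) μ :=
    hint _ (hprod.mul l.continuous) hpc.mul_right
  have a2 : Integrable (fun x => ψ x ^ 2 * l x) μ :=
    hint _ (hsq.mul l.continuous) hsqc.mul_right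
  have hi1 : Integrable (fun x => ψ x ^ 2) μ := hint _ hsq hsqc
  have hl : ∀ x, fderiv ℝ (fun y => l y) x e = 1 := by
    intro x
    rw [show fderiv ℝ (fun y => l y) x = l from l.fderiv, hle]
  have a1' : Integrable (fun x => fderiv ℝ (fun y => ψ y ^ 2) x e * l x) μ := by
    simpa only [hdsq] using a1
  have a3 : Integrable (fun x => ψ x ^ 2 * fderiv ℝ (fun y => l y) x e) μ := by
    simpa only [hl, mul_one] using hi1
  have hdsq' : ∀ x, DifferentiableAt ℝ (fun y => ψ y ^ 2) x := fun x => (hd1 x).fun_pow 2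
  have ibp : ∫ x, ψ x ^ 2 * fderiv ℝ (fun y => l y) x e ∂μ =
      -∫ x, fderiv ℝ (fun y => ψ y ^ 2) x e * l x ∂μ :=
    integral_mul_fderiv_eq_neg_fderiv_mul_of_integrable a1' a3 a2
      (fun x _ => hdsq' x) (fun x _ => l.differentiableAt)
  simp only [hl, mul_one, hdsq] at ibp
  have hi2 : Integrable (fun x => ‖gradient ψ x‖ ^ 2) μ := by
    have h1 : Continuous fun x => ‖gradient ψ x‖ * ‖gradient ψ x‖ := hcg.norm.mul hcg.norm
    have h2 : HasCompactSupport fun x => ‖gradient ψ x‖ * ‖gradient ψ x‖ := hgc.norm.mul_right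
    simp only [pow_two]
    exact hint _ h1 h2
  have key : ∫ x, ψ x ^ 2 ∂μ ≤ ∫ x, (1 / 2 * ψ x ^ 2 + 2 * R ^ 2 * ‖gradient ψ x‖ ^ 2) ∂μ := by
    rw [ibp, ← integral_neg]
    refine integral_mono ?_ ((hi1.const_mul _).add (hi2.const_mul _)) ?_
    · exact a1.neg
    · intro x
      simp only
      by_cases hx : ψ x = 0
      · rw [hx]
        have : 0 ≤ R ^ 2 * ‖gradient ψ x‖ ^ 2 := by positivity
        simp only [mul_zero, zero_mul, neg_zero]
        linarith
      · have hlx : |l x| ≤ R := (hnl x).trans (hs x hx)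
        have hg : |fderiv ℝ ψ x e| ≤ ‖gradient ψ x‖ := by
          rw [← inner_gradient_left]
          refine (abs_real_inner_le_norm _ _).trans ?_
          rw [hne, mul_one]
        have hm : |fderiv ℝ ψ x e * l x| ≤ ‖gradient ψ x‖ * R := by
          rw [abs_mul]
          exact mul_le_mul hg hlx (abs_nonneg _) (norm_nonneg _)
        have hm2 : (fderiv ℝ ψ x e * l x) ^ 2 ≤ (‖gradient ψ x‖ * R) ^ 2 := by
          rw [← sq_abs]
          exact pow_le_pow_left₀ (abs_nonneg _) hm 2
        nlinarith [sq_nonneg (ψ x + 2 * (fderiv ℝ ψ x e * l x))]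
  rw [integral_add (hi1.const_mul _) (hi2.const_mul _), integral_const_mul,
    integral_const_mul] at key
  linarith

/-- The Poincaré inequality on `H¹₀(Ω)`. -/
theorem poincare [NeZero d] (Ω : BoundedDomain d) :
    ∃ c : ℝ, ∀ v : H10 Ω, ‖toL2 Ω v‖ ≤ c * ‖grad Ω v‖ := by
  obtain ⟨R, hR0, hR⟩ := Ω.isBounded.exists_pos_norm_le
  have htest : ∀ p ∈ testPairs Ω, ‖p.1‖ ≤ 2 * R * ‖p.2‖ := by
    rintro ⟨u, g⟩ ⟨ψ, ⟨hψ, hc, hs⟩, h1, h2⟩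
    simp only at h1 h2 ⊢
    have hsupp : ∀ x, x ∉ Ω.carrier → ψ x = 0 := fun x hx =>
      image_eq_zero_of_notMem_tsupport fun h => hx (hs h)
    have hgsupp : ∀ x, x ∉ Ω.carrier → gradient ψ x = 0 := by
      intro x hx
      have hx' : x ∉ tsupport ψ := fun h => hx (hs h)
      have : fderiv ℝ ψ x = 0 := by
        by_contra h
        exact hx' (support_fderiv_subset ℝ h)
      simp [gradient, this]
    have hu : ‖u‖ ^ 2 = ∫ x, ψ x ^ 2 := by
      rw [← real_inner_self_eq_norm_sq, L2.inner_def,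
        ← setIntegral_eq_integral_of_forall_compl_eq_zero (s := Ω.carrier)
          (f := fun x => ψ x ^ 2) (fun x hx => by simp [hsupp x hx])]
      refine integral_congr_ae ?_
      filter_upwards [h1] with x hx
      rw [hx, real_inner_self_eq_norm_sq, Real.norm_eq_abs, sq_abs]
    have hg : ‖g‖ ^ 2 = ∫ x, ‖gradient ψ x‖ ^ 2 := by
      rw [← real_inner_self_eq_norm_sq, L2.inner_def,
        ← setIntegral_eq_integral_of_forall_compl_eq_zero (s := Ω.carrier)
          (f := fun x => ‖gradient ψ x‖ ^ 2) (fun x hx => by simp [hgsupp x hx])]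
      refine integral_congr_ae ?_
      filter_upwards [h2] with x hx
      rw [hx, real_inner_self_eq_norm_sq]
    have hp := poincare_smooth (R := R) volume
      (EuclideanSpace.single (0 : Fin d) (1 : ℝ)) (by simp) hψ hc
      (fun x hx => hR x (by by_contra h; exact hx (hsupp x h)))
    rw [← hu, ← hg] at hp
    refine le_of_sq_le_sq ?_ (by positivity)
    nlinarith
  refine ⟨2 * R, fun v => ?_⟩
  have hclosed : IsClosed {p : L2 Ω × L2Vec Ω | ‖p.1‖ ≤ 2 * R * ‖p.2‖} :=
    isClosed_le (by fun_prop) (by fun_prop)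
  exact closure_minimal htest hclosed v.2

/-- An element of `H¹₀(Ω)` is determined by its gradient. -/
theorem grad_injective [NeZero d] (Ω : BoundedDomain d) : Function.Injective (grad Ω) := by
  rw [injective_iff_map_eq_zero]
  intro v hv
  obtain ⟨c, hc⟩ := poincare Ω
  have h := hc v
  rw [hv, norm_zero, mul_zero] at h
  have h1 : toL2 Ω v = 0 := norm_le_zero_iff.mp h
  exact Subtype.ext (Prod.ext h1 hv)

/-- The Ritz projection onto a finite dimensional subspace `W` of `H¹₀(Ω)`: the orthogonal
projection onto `W` for the inner product `(∇v, ∇w)_{L²}`. -/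
def ritz [NeZero d] (Ω : BoundedDomain d) (W : Submodule ℝ (H10 Ω)) [FiniteDimensional ℝ W] :
    H10 Ω →ₗ[ℝ] H10 Ω :=
  W.subtype ∘ₗ (Submodule.equivMapOfInjective (grad Ω) (grad_injective Ω) W).symm.toLinearMap ∘ₗ
    (W.map (grad Ω)).orthogonalProjectionOnto.toLinearMap ∘ₗ grad Ω

theorem grad_ritz [NeZero d] (Ω : BoundedDomain d) (W : Submodule ℝ (H10 Ω))
    [FiniteDimensional ℝ W] (w : H10 Ω) :
    grad Ω (ritz Ω W w) = (W.map (grad Ω)).starProjection (grad Ω w) := by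
  have h := Submodule.coe_equivMapOfInjective_apply (grad Ω) (grad_injective Ω) W
    ((Submodule.equivMapOfInjective (grad Ω) (grad_injective Ω) W).symm
      ((W.map (grad Ω)).orthogonalProjectionOnto (grad Ω w)))
  rw [LinearEquiv.apply_symm_apply] at h
  exact h.symm

/-- The defining property of the Ritz projection. -/
theorem eq_ritz_iff [NeZero d] (Ω : BoundedDomain d) (W : Submodule ℝ (H10 Ω))
    [FiniteDimensional ℝ W] (w z : H10 Ω) :
    z = ritz Ω W w ↔ z ∈ W ∧ ∀ v ∈ W, ⟪grad Ω (w - z), grad Ω v⟫_ℝ = 0 := by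
  constructor
  · rintro rfl
    refine ⟨Subtype.coe_prop _, fun v hv => ?_⟩
    rw [map_sub, grad_ritz]
    exact Submodule.starProjection_inner_eq_zero _ _ (Submodule.mem_map_of_mem hv)
  · rintro ⟨hz, h⟩
    apply grad_injective Ω
    rw [grad_ritz]
    refine (Submodule.eq_starProjection_of_mem_of_inner_eq_zero
      (Submodule.mem_map_of_mem hz) ?_).symm
    rintro _ ⟨v, hv, rfl⟩
    rw [← map_sub]
    exact h v hv

section POD

variable {X : Type*} [NormedAddCommGroup X] [InnerProductSpace ℝ X] {M : ℕ}

/-- The weighted inner product `(g, h)_S = ∑ γ_j g^j h^j` on `S = ℝ^M`. -/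
def weightedInner (γ g h : Fin M → ℝ) : ℝ :=
  ∑ j, γ j * g j * h j

/-- The POD operator `K f = ∑ γ_j f^j w^j` of the snapshots `w` with the weights `γ`. -/
def podOperator (γ : Fin M → ℝ) (w : Fin M → X) (f : Fin M → ℝ) : X :=
  ∑ j, (γ j * f j) • w j

/-- `(lam k)^{1/2}, f k, φ k` is a singular value decomposition of the POD operator
`K : S → X` of the snapshots `w` with the weights `γ`: the `lam k` are nonnegative and in
nonincreasing order, the `f k` are orthonormal in `S`, the `φ k` are orthonormal in `X`, and
`K g = ∑ (lam k)^{1/2} (g, f k)_S φ k` for all `g`. Thus the `lam k` are the POD eigenvalues (all the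
positive ones, and possibly some zeros at the end) and the `φ k` are the POD modes. -/
structure IsPODSystem (γ : Fin M → ℝ) (w : Fin M → X) {m : ℕ} (lam : Fin m → ℝ)
    (f : Fin m → Fin M → ℝ) (φ : Fin m → X) : Prop where
  nonneg : ∀ k, 0 ≤ lam k
  antitone : Antitone lam
  right_orthonormal : ∀ i j, weightedInner γ (f i) (f j) = if i = j then 1 else 0
  left_orthonormal : Orthonormal ℝ φ
  expansion : ∀ g, podOperator γ w g = ∑ k, (√(lam k) * weightedInner γ g (f k)) • φ k

end POD

section DifferenceQuotients

variable {Z : Type*} [AddCommGroup Z] [Module ℝ Z]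

/-- The difference quotient `∂z^n = (z^{n+1} - z^n) / τ`. -/
def dq (τ : ℝ) (z : ℕ → Z) (n : ℕ) : Z :=
  τ⁻¹ • (z (n + 1) - z n)

/-- The data set of the new difference quotient approach: the first snapshot, followed by all
difference quotients of the `N` snapshots `u 0, …, u (N - 1)`. -/
def dq1Data (τ : ℝ) (N : ℕ) (u : ℕ → Z) (j : Fin N) : Z :=
  if (j : ℕ) = 0 then u 0 else dq τ u (j - 1)

/-- The weights of the new difference quotient approach: `1` for the first snapshot and the time
step for each difference quotient. -/
def dq1Weight (τ : ℝ) (N : ℕ) (j : Fin N) : ℝ :=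
  if (j : ℕ) = 0 then 1 else τ

end DifferenceQuotients

/-- `u 0, …, u (N - 1)` is a solution in the space `W ⊆ H¹₀(Ω)` of the backward Euler Galerkin
scheme for the heat equation with diffusion constant `ν`, forcing `F` and time step `τ`; here `u n`
belongs to the time `n τ`. -/
def IsBackwardEuler (Ω : BoundedDomain d) (ν τ : ℝ) (N : ℕ) (F : ℝ → L2 Ω)
    (W : Submodule ℝ (H10 Ω)) (u : ℕ → H10 Ω) : Prop :=
  (∀ n < N, u n ∈ W) ∧
  ∀ n, n + 1 < N → ∀ v ∈ W,
    ⟪toL2 Ω (dq τ u n), toL2 Ω v⟫_ℝ + ν * ⟪grad Ω (u (n + 1)), grad Ω v⟫_ℝ =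
      ⟪F ((n + 1 : ℕ) * τ), toL2 Ω v⟫_ℝ

/-- The span of the first `r` modes. -/
def modeSpan {Ω : BoundedDomain d} {m : ℕ} (φ : Fin m → H10 Ω) (r : ℕ) :
    Submodule ℝ (H10 Ω) :=
  Submodule.span ℝ (φ '' {k | (k : ℕ) < r})

instance {Ω : BoundedDomain d} {m : ℕ} (φ : Fin m → H10 Ω) (r : ℕ) :
    FiniteDimensional ℝ (modeSpan φ r) :=
  FiniteDimensional.span_of_finite ℝ (Set.toFinite _)

end PodHeat

end

open PodHeat

/-! Let `R` be the Ritz projection onto the mode span and write the error as `z - p`, with `z = u -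
R u` the projection error and `p = ur - R u` the discrete part. Ritz orthogonality removes the
gradient of `z` from the equation for `p`, so `p` solves a backward Euler scheme driven only by
`∂z`. Testing with `p` itself and absorbing the load by Poincaré bounds `p` by its initial value and
`S = ∑ τ ‖∂z‖²` (`error_equation`, `energy_step`). The data set contains the first snapshot and
every difference quotient, so `‖z 0‖² + S` is exactly the weighted POD projection error, and
Parseval turns it into the eigenvalue sum (`pod_projection_error`). The same two quantities control
`z` at every time by telescoping (`norm_sq_le_of_dq`), hence no negative power of the time step
appears. -/

namespace PodHeat

/-! ### Singular value decomposition of weighted snapshots -/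

section POD

variable {X : Type*} [NormedAddCommGroup X] [InnerProductSpace ℝ X] {M m : ℕ}

/-- Each snapshot with a nonzero weight is recovered from the singular value decomposition. -/
theorem IsPODSystem.snapshot_eq {γ : Fin M → ℝ} {w : Fin M → X} {lam : Fin m → ℝ}
    {f : Fin m → Fin M → ℝ} {φ : Fin m → X} (h : IsPODSystem γ w lam f φ) {j : Fin M}
    (hj : γ j ≠ 0) : w j = ∑ i, (√(lam i) * f i j) • φ i := by
  -- The unit vector rescaled by `(γ j)⁻¹` cancels the weight, both in the operator and in the inner
  -- product.
  have h1 : podOperator γ w (Pi.single j (γ j)⁻¹) = w j := by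
    rw [podOperator, Finset.sum_eq_single j]
    · rw [Pi.single_eq_same, mul_inv_cancel₀ hj, one_smul]
    · intro b _ hb
      rw [Pi.single_eq_of_ne hb, mul_zero, zero_smul]
    · simp
  have h2 : ∀ i, weightedInner γ (Pi.single j (γ j)⁻¹) (f i) = f i j := by
    intro i
    rw [weightedInner, Finset.sum_eq_single j]
    · rw [Pi.single_eq_same, mul_inv_cancel₀ hj, one_mul]
    · intro b _ hb
      rw [Pi.single_eq_of_ne hb, mul_zero, zero_mul]
    · simp
  rw [← h1, h.expansion]
  simp only [h2]

/-- Parseval's identity for a combination with coefficients orthonormal in the weighted inner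
product. -/
theorem sum_weight_mul_norm_sq {γ : Fin M → ℝ} {lam : Fin m → ℝ} {f : Fin m → Fin M → ℝ}
    (hlam : ∀ i, 0 ≤ lam i)
    (hf : ∀ i k, weightedInner γ (f i) (f k) = if i = k then 1 else 0) (p : Fin m → X) :
    ∑ j, γ j * ‖∑ i, (√(lam i) * f i j) • p i‖ ^ 2 = ∑ i, lam i * ‖p i‖ ^ 2 := by
  have h1 : ∀ j, γ j * ‖∑ i, (√(lam i) * f i j) • p i‖ ^ 2 =
      ∑ i, ∑ k, √(lam i) * √(lam k) * ⟪p i, p k⟫_ℝ * (γ j * f i j * f k j) := by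
    intro j
    rw [← real_inner_self_eq_norm_sq, sum_inner, Finset.mul_sum]
    refine Finset.sum_congr rfl fun i _ => ?_
    rw [inner_sum, Finset.mul_sum]
    refine Finset.sum_congr rfl fun k _ => ?_
    rw [real_inner_smul_left, real_inner_smul_right]
    ring
  simp only [h1]
  -- With the sum over `j` innermost, orthonormality of the `f i` leaves only the diagonal `k = i`.
  -- The `p i` need not be orthogonal, so they may later be projected modes.
  rw [Finset.sum_comm]
  refine Finset.sum_congr rfl fun i _ => ?_
  rw [Finset.sum_comm]
  simp only [← Finset.mul_sum]
  rw [Finset.sum_eq_single i]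
  · have := hf i i
    rw [weightedInner, if_pos rfl] at this
    rw [this, real_inner_self_eq_norm_sq, Real.mul_self_sqrt (hlam i), mul_one]
  · intro k _ hk
    have := hf i k
    rw [weightedInner, if_neg hk.symm] at this
    rw [this, mul_zero]
  · simp

end POD

/-! ### Difference quotients and pointwise control in time -/

section DifferenceQuotients

theorem map_dq {Z Y : Type*} [AddCommGroup Z] [Module ℝ Z] [AddCommGroup Y] [Module ℝ Y]
    (A : Z →ₗ[ℝ] Y) (τ : ℝ) (z : ℕ → Z) (n : ℕ) : A (dq τ z n) = dq τ (fun n => A (z n)) n := by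
  simp [dq]

theorem smul_dq {Z : Type*} [AddCommGroup Z] [Module ℝ Z] {τ : ℝ} (hτ : τ ≠ 0) (z : ℕ → Z)
    (n : ℕ) : τ • dq τ z n = z (n + 1) - z n := by
  rw [dq, smul_inv_smul₀ hτ]

/-- The sum over the data set of the new difference quotient approach, with its weights. -/
theorem sum_dq1 {Z : Type*} [AddCommGroup Z] [Module ℝ Z] (G : Z → ℝ) (τ : ℝ) (K : ℕ)
    (u : ℕ → Z) :
    ∑ j, dq1Weight τ (K + 1) j * G (dq1Data τ (K + 1) u j) =
      G (u 0) + ∑ n ∈ Finset.range K, τ * G (dq τ u n) := by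
  -- Index `0` is the first snapshot; index `n + 1` carries the quotient at `n`.
  rw [Fin.sum_univ_succ, ← Fin.sum_univ_eq_sum_range (fun n => τ * G (dq τ u n))]
  simp [dq1Weight, dq1Data]

/-- Telescoping from `z 0` followed by Cauchy–Schwarz in time. The factor `k * τ` is the elapsed
time, which stays bounded as the step shrinks. -/
theorem norm_sq_le_of_dq {Z : Type*} [NormedAddCommGroup Z] [NormedSpace ℝ Z] {τ : ℝ}
    (hτ : 0 < τ) (z : ℕ → Z) (k : ℕ) :
    ‖z k‖ ^ 2 ≤ 2 * ‖z 0‖ ^ 2 + 2 * (k * τ) * ∑ n ∈ Finset.range k, τ * ‖dq τ z n‖ ^ 2 := by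
  have h1 : ‖z k - z 0‖ ≤ ∑ n ∈ Finset.range k, τ * ‖dq τ z n‖ := by
    rw [← Finset.sum_range_sub]
    refine (norm_sum_le _ _).trans (le_of_eq (Finset.sum_congr rfl fun n _ => ?_))
    rw [← smul_dq hτ.ne', norm_smul, Real.norm_of_nonneg hτ.le]
  have h2 : (∑ n ∈ Finset.range k, τ * ‖dq τ z n‖) ^ 2 ≤
      k * τ * ∑ n ∈ Finset.range k, τ * ‖dq τ z n‖ ^ 2 := by
    refine sq_sum_le_card_mul_sum_sq.trans (le_of_eq ?_)
    rw [Finset.card_range, mul_assoc, Finset.mul_sum (a := τ)]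
    congr 1
    exact Finset.sum_congr rfl fun n _ => by ring
  have h3 : ‖z k‖ ≤ ‖z 0‖ + ‖z k - z 0‖ := by
    simpa using norm_add_le (z 0) (z k - z 0)
  have h4 := pow_le_pow_left₀ (norm_nonneg _) h1 2
  have h5 := pow_le_pow_left₀ (norm_nonneg _) h3 2
  nlinarith [sq_nonneg (‖z 0‖ - ‖z k - z 0‖)]

end DifferenceQuotients

/-! ### POD projection error, energy estimate and error equation -/

variable {d : ℕ}

theorem ritz_eq_self [NeZero d] (Ω : BoundedDomain d) (W : Submodule ℝ (H10 Ω))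
    [FiniteDimensional ℝ W] {w : H10 Ω} (hw : w ∈ W) : ritz Ω W w = w :=
  ((eq_ritz_iff Ω W w w).2 ⟨hw, by simp⟩).symm

/-- The projection error of the data set, measured with the weights of the new difference quotient
approach, is the sum over the modes of the eigenvalues times the projection errors. -/
theorem pod_projection_error [NeZero d] {Ω : BoundedDomain d} {τ : ℝ} (hτ : 0 < τ) {K m : ℕ}
    {u : ℕ → H10 Ω} {lam : Fin m → ℝ} {f : Fin m → Fin (K + 1) → ℝ} {φ : Fin m → H10 Ω}
    (h : IsPODSystem (dq1Weight τ (K + 1)) (dq1Data τ (K + 1) fun n => toL2 Ω (u n)) lam f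
      (fun k => toL2 Ω (φ k))) (r : ℕ) (z : ℕ → H10 Ω)
    (hz : ∀ n, z n = u n - ritz Ω (modeSpan φ r) (u n)) :
    ‖toL2 Ω (z 0)‖ ^ 2 + ∑ n ∈ Finset.range K, τ * ‖toL2 Ω (dq τ z n)‖ ^ 2 =
      ∑ i with r ≤ Fin.val i,
        lam i * ‖toL2 Ω (φ i - ritz Ω (modeSpan φ r) (φ i))‖ ^ 2 := by
  set A : H10 Ω →ₗ[ℝ] H10 Ω := LinearMap.id - ritz Ω (modeSpan φ r) with hA
  have hAz : ∀ n, z n = A (u n) := fun n => by simp [hA, hz]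
  have hdata : ∀ j, dq1Data τ (K + 1) u j = ∑ i, (√(lam i) * f i j) • φ i := by
    intro j
    -- The decomposition is given in `L²`, while the Ritz projection acts on `H¹₀`; injectivity
    -- lifts the expansion so that `A` can be applied to it.
    apply toL2_injective Ω
    have hj : dq1Weight τ (K + 1) j ≠ 0 := by
      rw [dq1Weight]
      split_ifs
      exacts [one_ne_zero, hτ.ne']
    have h1 := h.snapshot_eq hj
    have h2 : toL2 Ω (dq1Data τ (K + 1) u j) =
        dq1Data τ (K + 1) (fun n => toL2 Ω (u n)) j := by
      rw [dq1Data, dq1Data]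
      split_ifs
      exacts [rfl, map_dq _ _ _ _]
    rw [h2, h1]
    simp
  have hsum := sum_dq1 (fun w => ‖toL2 Ω (A w)‖ ^ 2) τ K u
  have hdq : ∀ n, dq τ z n = A (dq τ u n) := fun n => by
    rw [map_dq, show z = fun n => A (u n) from funext hAz]
  simp only [hdq, hAz]
  rw [← hsum]
  have hp := sum_weight_mul_norm_sq h.nonneg h.right_orthonormal (fun i => toL2 Ω (A (φ i)))
  simp only [hdata, map_sum, map_smul]
  rw [hp, Finset.sum_filter]
  refine Finset.sum_congr rfl fun i _ => ?_
  split_ifs with hi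
  · rfl
  -- The retained modes are fixed by the projection, hence killed by `A`.
  · have hm : φ i ∈ modeSpan φ r := Submodule.subset_span ⟨i, not_le.1 hi, rfl⟩
    simp [hA, ritz_eq_self Ω _ hm]

/-- One step of the energy estimate for the backward Euler scheme. -/
theorem energy_step {Ω : BoundedDomain d} {ν τ c : ℝ} (hν : 0 < ν) (hτ : 0 < τ)
    (hc : ∀ v : H10 Ω, ‖toL2 Ω v‖ ≤ c * ‖grad Ω v‖) {p : ℕ → H10 Ω} {n : ℕ} {y : L2 Ω}
    (h : ⟪toL2 Ω (dq τ p n), toL2 Ω (p (n + 1))⟫_ℝ + ν * ⟪grad Ω (p (n + 1)),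
      grad Ω (p (n + 1))⟫_ℝ = ⟪y, toL2 Ω (p (n + 1))⟫_ℝ) :
    ‖toL2 Ω (p (n + 1))‖ ^ 2 ≤ ‖toL2 Ω (p n)‖ ^ 2 + c ^ 2 / (2 * ν) * (τ * ‖y‖ ^ 2) := by
  set a := toL2 Ω (p (n + 1))
  set b := toL2 Ω (p n)
  have h1 : τ * ⟪toL2 Ω (dq τ p n), a⟫_ℝ = ‖a‖ ^ 2 - ⟪b, a⟫_ℝ := by
    rw [← real_inner_smul_left, ← map_smul, smul_dq hτ.ne', map_sub, inner_sub_left,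
      real_inner_self_eq_norm_sq]
  have h2 : ⟪b, a⟫_ℝ ≤ (‖a‖ ^ 2 + ‖b‖ ^ 2) / 2 := by
    have := real_inner_le_norm b a
    nlinarith [sq_nonneg (‖a‖ - ‖b‖)]
  set g := ‖grad Ω (p (n + 1))‖
  -- Poincaré and Young, with the weight chosen so that diffusion absorbs the whole gradient term.
  have h3 : ⟪y, a⟫_ℝ ≤ ν * g ^ 2 + c ^ 2 / (4 * ν) * ‖y‖ ^ 2 := by
    have e1 : ⟪y, a⟫_ℝ ≤ ‖y‖ * (c * g) :=
      (real_inner_le_norm y a).trans (mul_le_mul_of_nonneg_left (hc _) (norm_nonneg _))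
    have e2 : ν * g ^ 2 + c ^ 2 / (4 * ν) * ‖y‖ ^ 2 - ‖y‖ * (c * g) =
        ν * (g - c / (2 * ν) * ‖y‖) ^ 2 := by
      field_simp
      ring
    have e3 : 0 ≤ ν * (g - c / (2 * ν) * ‖y‖) ^ 2 := by positivity
    linarith
  rw [real_inner_self_eq_norm_sq] at h
  have h4 : ⟪toL2 Ω (dq τ p n), a⟫_ℝ ≤ c ^ 2 / (4 * ν) * ‖y‖ ^ 2 := by linarith
  have h5 := mul_le_mul_of_nonneg_left h4 hτ.le
  have h6 : c ^ 2 / (2 * ν) * (τ * ‖y‖ ^ 2) = 2 * (τ * (c ^ 2 / (4 * ν) * ‖y‖ ^ 2)) := by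
    field_simp
    ring
  linarith

/-- The difference between the reduced order solution and the Ritz projection of the full solution
solves a backward Euler scheme driven by the difference quotients of the projection error. -/
theorem error_equation [NeZero d] {Ω : BoundedDomain d} {ν τ : ℝ} {N : ℕ} {F : ℝ → L2 Ω}
    {V W : Submodule ℝ (H10 Ω)} [FiniteDimensional ℝ W] (hWV : W ≤ V) {u ur : ℕ → H10 Ω}
    (hu : IsBackwardEuler Ω ν τ N F V u) (hur : IsBackwardEuler Ω ν τ N F W ur) {n : ℕ}
    (hn : n + 1 < N) {v : H10 Ω} (hv : v ∈ W) :
    ⟪toL2 Ω (dq τ (fun n => ur n - ritz Ω W (u n)) n), toL2 Ω v⟫_ℝ +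
        ν * ⟪grad Ω (ur (n + 1) - ritz Ω W (u (n + 1))), grad Ω v⟫_ℝ =
      ⟪toL2 Ω (dq τ (fun n => u n - ritz Ω W (u n)) n), toL2 Ω v⟫_ℝ := by
  have h1 := hu.2 n hn v (hWV hv)
  have h2 := hur.2 n hn v hv
  have h3 := ((eq_ritz_iff Ω W (u (n + 1)) _).1 rfl).2 v hv
  -- Both schemes have the same load, which is eliminated here; `h3` then trades the gradient of `u`
  -- for that of its Ritz projection.
  rw [← h1] at h2
  simp only [dq, map_smul, map_sub, inner_sub_left, real_inner_smul_left] at h2 h3 ⊢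
  linear_combination h2 + ν * h3

end PodHeat

/-- Times and modes are counted from `0`. Letting the sum run over all remaining modes changes
nothing, since a zero eigenvalue contributes zero. -/
theorem mainTheorem5 (d : ℕ) [NeZero d] (Ω : BoundedDomain d) (ν T : ℝ) (hν : 0 < ν)
    (hT : 0 < T) :
    ∃ C : ℝ, 0 < C ∧
      ∀ (Vh : Submodule ℝ (H10 Ω)) [FiniteDimensional ℝ Vh] (N : ℕ), 2 ≤ N →
      ∀ τ : ℝ, τ = T / ((N : ℝ) - 1) →
      ∀ (F : ℝ → L2 Ω) (u : ℕ → H10 Ω), IsBackwardEuler Ω ν τ N F Vh u →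
      ∀ (m : ℕ) (lam : Fin m → ℝ) (f : Fin m → Fin N → ℝ) (φ : Fin m → H10 Ω),
        (∀ k, φ k ∈ Vh) →
        IsPODSystem (dq1Weight τ N) (dq1Data τ N fun n => toL2 Ω (u n)) lam f
          (fun k => toL2 Ω (φ k)) →
      ∀ (r : ℕ) (ur : ℕ → H10 Ω), IsBackwardEuler Ω ν τ N F (modeSpan φ r) ur →
      ∀ k < N,
        ‖toL2 Ω (u k - ur k)‖ ^ 2 ≤
          C * ((∑ i with r ≤ Fin.val i,
                lam i * ‖toL2 Ω (φ i - ritz Ω (modeSpan φ r) (φ i))‖ ^ 2) +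
            ‖toL2 Ω (ur 0 - ritz Ω (modeSpan φ r) (u 0))‖ ^ 2) := by
  obtain ⟨c, hc⟩ := poincare Ω
  -- Splitting the error costs a factor `2`, giving coefficients `4` for `‖z 0‖²`, `4 * T + c ^ 2 /
  -- ν` for `S` and `2` for `‖p 0‖²`; the constant dominates all three.
  refine ⟨4 + 4 * T + c ^ 2 / ν, by positivity, ?_⟩
  intro Vh _ N hN τ hτ F u hu m lam f φ hφ hpod r ur hur k hk
  -- `K` is the number of time steps, so `K * τ = T`.
  obtain ⟨K, rfl⟩ : ∃ K, N = K + 1 := ⟨N - 1, by omega⟩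
  have hK : (0 : ℝ) < K := by exact_mod_cast (by omega : 0 < K)
  have hKτ : K * τ = T := by
    rw [hτ]
    push_cast
    rw [add_sub_cancel_right, mul_div_cancel₀ _ hK.ne']
  have hτ0 : 0 < τ := by
    rw [hτ]
    push_cast
    rw [add_sub_cancel_right]
    positivity
  have hWV : modeSpan φ r ≤ Vh := Submodule.span_le.2 fun v ⟨i, _, hi⟩ => hi ▸ hφ i
  set z : ℕ → H10 Ω := fun n => u n - ritz Ω (modeSpan φ r) (u n) with hz
  set p : ℕ → H10 Ω := fun n => ur n - ritz Ω (modeSpan φ r) (u n) with hp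
  have hproj := pod_projection_error hτ0 hpod r z fun n => rfl
  rw [← hproj]
  set S := ∑ n ∈ Finset.range K, τ * ‖toL2 Ω (dq τ z n)‖ ^ 2 with hS
  have hterm : ∀ n, 0 ≤ τ * ‖toL2 Ω (dq τ z n)‖ ^ 2 := fun n => by positivity
  have hS0 : 0 ≤ S := Finset.sum_nonneg fun n _ => hterm n
  have hle : ∀ k ≤ K, ∑ n ∈ Finset.range k, τ * ‖toL2 Ω (dq τ z n)‖ ^ 2 ≤ S := fun k hk =>
    Finset.sum_le_sum_of_subset_of_nonneg (Finset.range_mono hk) fun n _ _ => hterm n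
  have henergy : ∀ k ≤ K, ‖toL2 Ω (p k)‖ ^ 2 ≤ ‖toL2 Ω (p 0)‖ ^ 2 +
      c ^ 2 / (2 * ν) * ∑ n ∈ Finset.range k, τ * ‖toL2 Ω (dq τ z n)‖ ^ 2 := by
    intro k
    induction k with
    | zero => simp
    | succ k ih =>
      intro hk
      -- This makes `p (k + 1)` an admissible test function in its own error equation.
      have hv : p (k + 1) ∈ modeSpan φ r :=
        Submodule.sub_mem _ (hur.1 _ (by omega)) ((eq_ritz_iff Ω _ _ _).1 rfl).1
      have h1 := energy_step hν hτ0 hc (error_equation hWV hu hur (by omega) hv)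
      have h2 := ih (by omega)
      rw [Finset.sum_range_succ, mul_add]
      linarith
  have hkK : k ≤ K := by omega
  have h1 : ‖toL2 Ω (p k)‖ ^ 2 ≤ ‖toL2 Ω (p 0)‖ ^ 2 + c ^ 2 / (2 * ν) * S :=
    (henergy k hkK).trans (by have := hle k hkK; gcongr)
  have h2 : ‖toL2 Ω (z k)‖ ^ 2 ≤ 2 * ‖toL2 Ω (z 0)‖ ^ 2 + 2 * T * S := by
    have h := norm_sq_le_of_dq hτ0 (fun n => toL2 Ω (z n)) k
    simp only [← map_dq] at h
    refine h.trans ?_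
    have e1 : k * τ ≤ T := by
      rw [← hKτ]
      gcongr
    have e2 := hle k hkK
    gcongr
  have h3 : ‖toL2 Ω (u k - ur k)‖ ≤ ‖toL2 Ω (z k)‖ + ‖toL2 Ω (p k)‖ := by
    have e : u k - ur k = z k - p k := by simp [hz, hp]
    rw [e, map_sub]
    exact norm_sub_le _ _
  have h4 : ‖toL2 Ω (u k - ur k)‖ ^ 2 ≤ 2 * ‖toL2 Ω (z k)‖ ^ 2 + 2 * ‖toL2 Ω (p k)‖ ^ 2 := by
    have := pow_le_pow_left₀ (norm_nonneg _) h3 2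
    nlinarith [sq_nonneg (‖toL2 Ω (z k)‖ - ‖toL2 Ω (p k)‖)]
  change _ ≤ _ * (_ + S + ‖toL2 Ω (p 0)‖ ^ 2)
  have h5 : c ^ 2 / (2 * ν) * S = c ^ 2 / ν * S / 2 := by
    field_simp
  have h6 : 0 ≤ c ^ 2 / ν := by positivity
  have q1 : 0 ≤ ‖toL2 Ω (z 0)‖ ^ 2 := by positivity
  have q2 : 0 ≤ ‖toL2 Ω (p 0)‖ ^ 2 := by positivity
  nlinarith [mul_nonneg h6 q1, mul_nonneg h6 q2, mul_nonneg hT.le q1, mul_nonneg hT.le q2]
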